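/- Let $\underline D=(D,C,\widehat C,\ll)$ be an extended distributive contact lattice (EDC-lattice), i.e. a bounded distributive lattice $(D,\le,0,1,+,\cdot)$ with three binary relations $C$ (contact), $\widehat C$ (dual contact), $\ll$ (nontangential part-of) satisfying, with $\overline R$ denoting the complement of $R$: (C1) $aCb\Rightarrow a,b\ne0$; (C2) $aCb,\ a\le a',\ b\le b'\Rightarrow a'Cb'$; (C3) $aC(b+c)\Rightarrow aCb$ or $aCc$; (C4) $aCb\Rightarrow bCa$; (C5) $a\cdot b\ne0\Rightarrow aCb$; ($\widehat C$1)–($\widehat C$5): the lattice duals of (C1)–(C5), obtained by exchanging $0,1$; $+,\cdot$; $\le,\ge$; $C,\widehat C$; ($\ll$1) $0\ll0$; ($\ll$2) $1\ll1$; ($\ll$3) $a\ll b\Rightarrow a\le b$; ($\ll$4) $a'\le a\ll b\le b'\Rightarrow a'\ll b'$; ($\ll$5) $a\ll c,\ b\ll c\Rightarrow a+b\ll c$; ($\ll$6) $c\ll a,\ c\ll b\Rightarrow c\ll a\cdot b$; ($\ll$7) $a\ll b,\ b\cdot c\ll d,\ c\ll a+d\Rightarrow c\ll d$; (MC1) $aCb,\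 a\ll c\Rightarrow aC(b\cdot c)$; (MC2) $a\overline C(b\cdot c),\ aCb,\ (a\cdot d)\overline Cb\Rightarrow d\widehat Cc$; (M$\widehat C$1) $a\widehat Cb,\ c\ll a\Rightarrow a\widehat C(b+c)$; (M$\widehat C$2) $a\overline{\widehat C}(b+c),\ a\widehat Cb,\ (a+d)\overline{\widehat C}b\Rightarrow dCc$; (M$\ll$1) $a\overline{\widehat C}b,\ a\cdot c\ll b\Rightarrow c\ll b$; (M$\ll$2) $a\overline Cb,\ b\ll a+c\Rightarrow b\ll c$. Assume that $\underline D$ is *U-rich*, i.e. - (Ext $\widehat O$) if $a\not\le b$, then there is $c$ with $a+c=1$ and $b+c\ne1$; - (U-rich $\ll$) if $a\ll b$, then there is $c$ with $b+c=1$ and $a\overline Cc$; - (U-rich $\widehat C$) if $a\overline{\widehat C}b$, then there are $c,d$ with $a+c=1$, $b+d=1$ and $c\overline Cd$; and that it satisfies - (Ext C) if $a\ne1$, then there is $b\ne0$ with $a\overline Cb$; - (Nor 1) if $a\overline Cb$, then there are $c,d$ with $c+d=1$, $a\overline Cc$ and $b\overline Cd$. A *clan* is a set $\Gamma\subseteq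 D$ with $1\in\Gamma$, $0\notin\Gamma$, that is upward closed, such that $a+b\in\Gamma$ implies $a\in\Gamma$ or $b\in\Gamma$, and such that $aCb$ for all $a,b\in\Gamma$. A *cluster* is a clan $\Gamma$ such that every $a\in D$ with $aCb$ for all $b\in\Gamma$ belongs to $\Gamma$. Let $X$ be the set of clusters of $\underline D$, and for $a\in D$ put $h(a)=\{\Gamma\in X: a\in\Gamma\}$. Then $\{h(a):a\in D\}$ is a closed base of a topology on $X$ (every closed set is an intersection of sets $h(a)$), and with this topology: 1. $X$ is a compact Hausdorff space. 2. Every $h(a)$ is regular closed, and $h$ is an embedding of $\underline D$ into the Boolean contact algebra $RC(X)$ of regular closed subsets of $X$, in which $\alpha+\beta=\alpha\cup\beta$, $\alpha\cdot\beta=\mathrm{Cl}(\mathrm{Int}(\alpha\cap\beta))$, $\alpha^*=\mathrm{Cl}(X\setminus\alpha)$, $0=\varnothing$, $1=X$, and $\alpha C\beta$ iff $\alpha\cap\beta\neq\varnothing$, $\alpha\widehat C\beta$ iff $\alpha^*C\beta^*$, $\alpha\ll\beta$ iff $\alpha\overline C\beta^*$. That is, $h$ is injective, preserves $0,1,+,\cdot$,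 and preserves and reflects $C,\widehat C,\ll$. 3. $h$ is *dually dense*: for every $\alpha\in RC(X)$ with $\alpha\neq X$ there is $a\in D$ with $\alpha\subseteq h(a)\neq X$. 4. $h$ is *$C$-separable*: for all $\alpha,\beta\in RC(X)$: if $\alpha\overline C\beta$, there are $a,b\in D$ with $\alpha\subseteq h(a)$, $\beta\subseteq h(b)$, $h(a)\overline Ch(b)$; if $\alpha\overline{\widehat C}\beta$, there are $a,b\in D$ with $\alpha+h(a)=1$, $\beta+h(b)=1$, $h(a)\overline Ch(b)$; if $\alpha\ll\beta$, there are $a,b\in D$ with $\alpha\subseteq h(a)$, $\beta+h(b)=1$, $h(a)\overline Ch(b)$. 5. Let (Con C) be the axiom: $a\ne0$, $b\ne0$ and $a+b=1$ imply $aCb$. Then $\underline D$ satisfies (Con C) if and only if $RC(X)$ satisfies (Con C), and in this case $X$ is connected, in the sense that $X$ is not the union of two disjoint nonempty open sets. -/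

import Mathlib

/-- An extended distributive contact lattice (EDC-lattice): a bounded distributive lattice
(`0, 1, +, ·` are `⊥, ⊤, ⊔, ⊓`) with contact `C`, dual contact `Ĉ` and nontangential
part-of `≪`. -/
class EDCLattice (D : Type*) extends DistribLattice D, BoundedOrder D where
  /-- contact `a C b` -/
  Con : D → D → Prop
  /-- dual contact `a Ĉ b` -/
  DCon : D → D → Prop
  /-- nontangential part-of `a ≪ b` -/
  Ntp : D → D → Prop
  c1 : ∀ a b : D, Con a b → a ≠ ⊥ ∧ b ≠ ⊥
  c2 : ∀ a b a' b' : D, Con a b → a ≤ a' → b ≤ b' → Con a' b'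
  c3 : ∀ a b c : D, Con a (b ⊔ c) → Con a b ∨ Con a c
  c4 : ∀ a b : D, Con a b → Con b a
  c5 : ∀ a b : D, a ⊓ b ≠ ⊥ → Con a b
  dc1 : ∀ a b : D, DCon a b → a ≠ ⊤ ∧ b ≠ ⊤
  dc2 : ∀ a b a' b' : D, DCon a b → a' ≤ a → b' ≤ b → DCon a' b'
  dc3 : ∀ a b c : D, DCon a (b ⊓ c) → DCon a b ∨ DCon a c
  dc4 : ∀ a b : D, DCon a b → DCon b a
  dc5 : ∀ a b : D, a ⊔ b ≠ ⊤ → DCon a b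
  ntp1 : Ntp ⊥ ⊥
  ntp2 : Ntp ⊤ ⊤
  ntp3 : ∀ a b : D, Ntp a b → a ≤ b
  ntp4 : ∀ a' a b b' : D, a' ≤ a → Ntp a b → b ≤ b' → Ntp a' b'
  ntp5 : ∀ a b c : D, Ntp a c → Ntp b c → Ntp (a ⊔ b) c
  ntp6 : ∀ a b c : D, Ntp c a → Ntp c b → Ntp c (a ⊓ b)
  ntp7 : ∀ a b c d : D, Ntp a b → Ntp (b ⊓ c) d → Ntp c (a ⊔ d) → Ntp c d
  mc1 : ∀ a b c : D, Con a b → Ntp a c → Con a (b ⊓ c)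
  mc2 : ∀ a b c d : D, ¬ Con a (b ⊓ c) → Con a b → ¬ Con (a ⊓ d) b → DCon d c
  mdc1 : ∀ a b c : D, DCon a b → Ntp c a → DCon a (b ⊔ c)
  mdc2 : ∀ a b c d : D, ¬ DCon a (b ⊔ c) → DCon a b → ¬ DCon (a ⊔ d) b → Con d c
  mntp1 : ∀ a b c : D, ¬ DCon a b → Ntp (a ⊓ c) b → Ntp c b
  mntp2 : ∀ a b c : D, ¬ Con a b → Ntp b (a ⊔ c) → Ntp b c

namespace EDCLattice

section Axioms

variable (D : Type*) [EDCLattice D]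

/-- (Ext Ô), extensionality of underlap. -/
def ExtUnderlap : Prop :=
  ∀ a b : D, ¬ a ≤ b → ∃ c : D, a ⊔ c = ⊤ ∧ b ⊔ c ≠ ⊤

/-- (U-rich ≪). -/
def URichNtp : Prop :=
  ∀ a b : D, Ntp a b → ∃ c : D, b ⊔ c = ⊤ ∧ ¬ Con a c

/-- (U-rich Ĉ). -/
def URichDCon : Prop :=
  ∀ a b : D, ¬ DCon a b → ∃ c d : D, a ⊔ c = ⊤ ∧ b ⊔ d = ⊤ ∧ ¬ Con c d

/-- U-rich EDC-lattices. -/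
def URich : Prop :=
  ExtUnderlap D ∧ URichNtp D ∧ URichDCon D

/-- (Ext C), C-extensionality. -/
def ExtC : Prop :=
  ∀ a : D, a ≠ ⊤ → ∃ b : D, b ≠ ⊥ ∧ ¬ Con a b

/-- (Con C), C-connectedness. -/
def ConC : Prop :=
  ∀ a b : D, a ≠ ⊥ → b ≠ ⊥ → a ⊔ b = ⊤ → Con a b

/-- (Nor 1). -/
def Nor1 : Prop :=
  ∀ a b : D, ¬ Con a b → ∃ c d : D, c ⊔ d = ⊤ ∧ ¬ Con a c ∧ ¬ Con b d

end Axioms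

section Maps

variable {D₁ D₂ : Type*} [EDCLattice D₁] [EDCLattice D₂]

/-- Embeddings of EDC-lattices: injective homomorphisms of bounded lattices which preserve and
reflect the three relations. -/
structure IsEmbedding (h : D₁ → D₂) : Prop where
  injective : Function.Injective h
  map_bot : h ⊥ = ⊥
  map_top : h ⊤ = ⊤
  map_sup : ∀ a b, h (a ⊔ b) = h a ⊔ h b
  map_inf : ∀ a b, h (a ⊓ b) = h a ⊓ h b
  con_iff : ∀ a b, Con (h a) (h b) ↔ Con a b
  dcon_iff : ∀ a b, DCon (h a) (h b) ↔ DCon a b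
  ntp_iff : ∀ a b, Ntp (h a) (h b) ↔ Ntp a b

/-- The image of `h` is dually dense. -/
def DuallyDense (h : D₁ → D₂) : Prop :=
  ∀ a₂ : D₂, a₂ ≠ ⊤ → ∃ a₁ : D₁, a₂ ≤ h a₁ ∧ h a₁ ≠ ⊤

/-- The image of `h` is C-separable. -/
structure CSeparable (h : D₁ → D₂) : Prop where
  con : ∀ a₂ b₂ : D₂, ¬ Con a₂ b₂ →
    ∃ a₁ b₁ : D₁, a₂ ≤ h a₁ ∧ b₂ ≤ h b₁ ∧ ¬ Con (h a₁) (h b₁)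
  dcon : ∀ a₂ b₂ : D₂, ¬ DCon a₂ b₂ →
    ∃ a₁ b₁ : D₁, a₂ ⊔ h a₁ = ⊤ ∧ b₂ ⊔ h b₁ = ⊤ ∧ ¬ Con (h a₁) (h b₁)
  ntp : ∀ a₂ b₂ : D₂, Ntp a₂ b₂ →
    ∃ a₁ b₁ : D₁, a₂ ≤ h a₁ ∧ b₂ ⊔ h b₁ = ⊤ ∧ ¬ Con (h a₁) (h b₁)

end Maps

section Clusters

variable {D : Type*} [EDCLattice D]

/-- Clans. -/
structure IsClan (Γ : Set D) : Prop where
  top_mem : ⊤ ∈ Γ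
  bot_notMem : ⊥ ∉ Γ
  mem_of_le : ∀ a b : D, a ∈ Γ → a ≤ b → b ∈ Γ
  mem_or_mem : ∀ a b : D, a ⊔ b ∈ Γ → a ∈ Γ ∨ b ∈ Γ
  con : ∀ a b : D, a ∈ Γ → b ∈ Γ → Con a b

/-- Clusters. -/
structure IsCluster (Γ : Set D) : Prop extends IsClan Γ where
  mem_of_con : ∀ a : D, (∀ b ∈ Γ, Con a b) → a ∈ Γ

variable (D) in
/-- The set of clusters of `D`, the point set of the canonical space. -/
def ClusterSpace : Type _ := {Γ : Set D // IsCluster Γ}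

/-- The set of clusters containing `a`. -/
def clustersContaining (a : D) : Set (ClusterSpace D) := {Γ | a ∈ Γ.1}

/-- The topology on the set of clusters generated by the sets `clustersContaining a` as closed
sets. -/
instance : TopologicalSpace (ClusterSpace D) :=
  TopologicalSpace.generateFrom (Set.range fun a : D => (clustersContaining a)ᶜ)

end Clusters

end EDCLattice

/-- Boolean contact algebras. -/
class ContactAlgebra (B : Type*) extends BooleanAlgebra B where
  /-- contact -/
  Contact : B → B → Prop
  contact_ne : ∀ a b : B, Contact a b → a ≠ ⊥ ∧ b ≠ ⊥
  contact_mono : ∀ a b a' b' : B, Contact a b → a ≤ a' → b ≤ b' → Contact a' b'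
  contact_sup : ∀ a b c : B, Contact a (b ⊔ c) → Contact a b ∨ Contact a c
  contact_symm : ∀ a b : B, Contact a b → Contact b a
  contact_of_inf : ∀ a b : B, a ⊓ b ≠ ⊥ → Contact a b

namespace ContactAlgebra

variable {B : Type*} [ContactAlgebra B]

theorem contact_split {a b : B} (h : Contact a b) (c : B) :
    Contact a (b ⊓ c) ∨ Contact a (b ⊓ cᶜ) := by
  apply contact_sup
  rwa [← inf_sup_left, sup_compl_eq_top, inf_top_eq]

theorem contact_split' {a b : B} (h : Contact a b) (c : B) :
    Contact (a ⊓ c) b ∨ Contact (a ⊓ cᶜ) b :=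
  (contact_split (contact_symm _ _ h) c).imp (contact_symm _ _) (contact_symm _ _)

/-- Every contact algebra is an EDC-lattice, with `a Ĉ b` iff `a* C b*`, and `a ≪ b` iff not
`a C b*`. -/
instance toEDCLattice : EDCLattice B where
  Con := Contact
  DCon a b := Contact aᶜ bᶜ
  Ntp a b := ¬ Contact a bᶜ
  c1 := contact_ne
  c2 := contact_mono
  c3 := contact_sup
  c4 := contact_symm
  c5 := contact_of_inf
  dc1 a b h := by
    have := contact_ne _ _ h
    exact ⟨fun e => this.1 (by simp [e]), fun e => this.2 (by simp [e])⟩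
  dc2 a b a' b' h h1 h2 :=
    contact_mono _ _ _ _ h (compl_le_compl h1) (compl_le_compl h2)
  dc3 a b c h := contact_sup _ _ _ (by rwa [← compl_inf])
  dc4 a b h := contact_symm _ _ h
  dc5 a b h := contact_of_inf _ _ fun e => h (by
    rw [← compl_sup, compl_eq_bot] at e; exact e)
  ntp1 h := (contact_ne _ _ h).1 rfl
  ntp2 h := (contact_ne _ _ h).2 compl_top
  ntp3 a b h := by
    by_contra hab
    exact h (contact_of_inf _ _ fun e => hab (by
      rwa [← sdiff_eq, sdiff_eq_bot_iff] at e))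
  ntp4 a' a b b' h1 h h2 h' :=
    h (contact_mono _ _ _ _ h' h1 (compl_le_compl h2))
  ntp5 a b c h1 h2 h := by
    rcases contact_sup _ _ _ (contact_symm _ _ h) with h | h
    · exact h1 (contact_symm _ _ h)
    · exact h2 (contact_symm _ _ h)
  ntp6 a b c h1 h2 h := by
    rw [compl_inf] at h
    exact (contact_sup _ _ _ h).elim h1 h2
  ntp7 a b c d h1 h2 h3 h := by
    rcases contact_split' h b with h' | h'
    · exact h2 (by rwa [inf_comm])
    · rcases contact_split h' a with h'' | h''
      · exact h1 (contact_symm _ _ (contact_mono _ _ _ _ h'' inf_le_right inf_le_right))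
      · refine h3 (contact_mono _ _ _ _ h'' inf_le_left ?_)
        rw [compl_sup, inf_comm]
  mc1 a b c h h1 := (contact_split h c).resolve_right fun h' =>
    h1 (contact_mono _ _ _ _ h' le_rfl inf_le_right)
  mc2 a b c d h1 h h2 := by
    have h' := (contact_split h c).resolve_left h1
    rcases contact_split' h' d with h'' | h''
    · exact absurd (contact_mono _ _ _ _ h'' le_rfl inf_le_left) h2
    · exact contact_mono _ _ _ _ h'' inf_le_right inf_le_right
  mdc1 a b c h h1 := by
    rw [compl_sup]
    exact (contact_split h c).resolve_left fun h' =>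
      h1 (contact_symm _ _ (contact_mono _ _ _ _ h' le_rfl inf_le_right))
  mdc2 a b c d h1 h h2 := by
    rw [compl_sup] at h1 h2
    have h' := (contact_split h c).resolve_right h1
    rcases contact_split' h' d with h'' | h''
    · exact contact_mono _ _ _ _ h'' inf_le_right inf_le_right
    · exact absurd (contact_mono _ _ _ _ h'' le_rfl inf_le_left) h2
  mntp1 a b c h1 h2 h := by
    rcases contact_split' h a with h' | h'
    · exact h2 (by rwa [inf_comm])
    · exact h1 (contact_mono _ _ _ _ h' inf_le_right le_rfl)
  mntp2 a b c h1 h2 h := by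
    rcases contact_split h a with h' | h'
    · exact h1 (contact_symm _ _ (contact_mono _ _ _ _ h' le_rfl inf_le_right))
    · exact h2 (by rwa [compl_sup, inf_comm])

end ContactAlgebra

/-- `RC(X)`: the regular closed subsets of `X`. -/
@[ext]
structure RegularClosed (X : Type*) [TopologicalSpace X] where
  /-- the underlying set -/
  carrier : Set X
  closure_interior : closure (interior carrier) = carrier

namespace RegularClosed

variable {X : Type*} [TopologicalSpace X]

theorem isClosed (a : RegularClosed X) : IsClosed a.carrier := by
  rw [← a.closure_interior]; exact isClosed_closure

theorem closure_interior_of_isOpen {s : Set X} (hs : IsOpen s) :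
    closure (interior (closure s)) = closure s :=
  subset_antisymm (closure_minimal interior_subset isClosed_closure)
    (closure_mono (interior_maximal subset_closure hs))

theorem subset_closure_interior (a : RegularClosed X) {s : Set X} (h : a.carrier ⊆ s) :
    a.carrier ⊆ closure (interior s) := by
  conv_lhs => rw [← a.closure_interior]
  exact closure_mono (interior_mono h)

/-- The Boolean algebra of regular closed sets: `a + b = a ∪ b`, `a · b = Cl (Int (a ∩ b))`,
`a* = Cl (-a)`. -/
instance : BooleanAlgebra (RegularClosed X) where
  le a b := a.carrier ⊆ b.carrier
  le_refl _ := subset_rfl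
  le_trans _ _ _ h1 h2 := h1.trans h2
  le_antisymm _ _ h1 h2 := RegularClosed.ext (subset_antisymm h1 h2)
  sup a b := ⟨a.carrier ∪ b.carrier, subset_antisymm
    (closure_minimal interior_subset (a.isClosed.union b.isClosed))
    (Set.union_subset (a.subset_closure_interior Set.subset_union_left)
      (b.subset_closure_interior Set.subset_union_right))⟩
  le_sup_left _ _ := Set.subset_union_left
  le_sup_right _ _ := Set.subset_union_right
  sup_le _ _ _ h1 h2 := Set.union_subset h1 h2
  inf a b := ⟨closure (interior (a.carrier ∩ b.carrier)),
    closure_interior_of_isOpen isOpen_interior⟩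
  inf_le_left a b := closure_minimal (interior_subset.trans Set.inter_subset_left) a.isClosed
  inf_le_right a b := closure_minimal (interior_subset.trans Set.inter_subset_right) b.isClosed
  le_inf a _ _ h1 h2 := a.subset_closure_interior (Set.subset_inter h1 h2)
  le_sup_inf a b c := by
    change closure (interior ((a.carrier ∪ b.carrier) ∩ (a.carrier ∪ c.carrier))) ⊆
      a.carrier ∪ closure (interior (b.carrier ∩ c.carrier))
    rw [← Set.union_inter_distrib_left]
    refine closure_minimal (fun x hx => ?_) (a.isClosed.union isClosed_closure)
    by_cases hxa : x ∈ a.carrier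
    · exact Or.inl hxa
    · refine Or.inr (subset_closure ?_)
      refine mem_interior.2 ⟨interior (a.carrier ∪ b.carrier ∩ c.carrier) ∩ a.carrierᶜ,
        fun y hy => (interior_subset hy.1).resolve_left hy.2,
        isOpen_interior.inter a.isClosed.isOpen_compl, hx, hxa⟩
  top := ⟨Set.univ, by simp⟩
  bot := ⟨∅, by simp⟩
  le_top _ := Set.subset_univ _
  bot_le _ := Set.empty_subset _
  compl a := ⟨closure a.carrierᶜ, closure_interior_of_isOpen a.isClosed.isOpen_compl⟩
  inf_compl_le_bot a := by
    change closure (interior (a.carrier ∩ closure a.carrierᶜ)) ⊆ ∅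
    have h : a.carrier ∩ closure a.carrierᶜ = frontier a.carrier := by
      rw [frontier_eq_closure_inter_closure, a.isClosed.closure_eq]
    rw [h, interior_frontier a.isClosed, closure_empty]
  top_le_sup_compl a := fun x _ => by
    by_cases hx : x ∈ a.carrier
    · exact Or.inl hx
    · exact Or.inr (subset_closure hx)

/-- The contact algebra `RC(X)`: two regular closed sets are in contact iff they meet. -/
instance : ContactAlgebra (RegularClosed X) where
  Contact a b := (a.carrier ∩ b.carrier).Nonempty
  contact_ne a b h := by
    obtain ⟨x, hxa, hxb⟩ := h
    constructor
    · rintro rfl; exact hxa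
    · rintro rfl; exact hxb
  contact_mono _ _ _ _ h h1 h2 := h.mono (Set.inter_subset_inter h1 h2)
  contact_sup a b c h := by
    obtain ⟨x, hxa, hx | hx⟩ := h
    · exact Or.inl ⟨x, hxa, hx⟩
    · exact Or.inr ⟨x, hxa, hx⟩
  contact_symm a b h := by rwa [Set.inter_comm]
  contact_of_inf a b h := by
    by_contra hn
    rw [Set.not_nonempty_iff_eq_empty] at hn
    refine h (RegularClosed.ext ?_)
    change closure (interior (a.carrier ∩ b.carrier)) = ∅
    simp [hn]

end RegularClosed

/-! Everything rests on a supply of clusters obtained without maximality arguments on clans: under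
(Nor 1), the elements in contact with every member of a clan already form a cluster
(`IsClan.isCluster_setOf_con`). For clans that are prime filters this gives a cluster through any
two elements in contact; for the clan that an ultrafilter on X induces it gives the limit, hence
compactness. (Ext Ô) and (Ext C) make h an order embedding with regular closed values. Compactness
then separates disjoint regular closed sets by sets h(a), h(b), which is C-separability. The
relations Ĉ and ≪ of RC(X) thus reduce to contact between elements of D; the U-rich axioms give the
same reduction inside D, so h preserves and reflects them. Separability also carries (Con C) up to
RC(X). -/

namespace EDCLattice

open Topology

variable {D : Type*} [EDCLattice D]

/-! ### Reducing dual contact and nontangential part-of to contact. -/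

section Relations

variable {a b c d : D}

theorem Con.symm (h : Con a b) : Con b a := c4 _ _ h

theorem Con.mono {a' b' : D} (h : Con a b) (ha : a ≤ a') (hb : b ≤ b') : Con a' b' :=
  c2 _ _ _ _ h ha hb

theorem con_self (h : a ≠ ⊥) : Con a a := c5 _ _ (by rwa [inf_idem])

theorem not_dcon_top_left : ¬ DCon (⊤ : D) b := fun h => (dc1 _ _ h).1 rfl

theorem not_dcon_top_right : ¬ DCon a (⊤ : D) := fun h => (dc1 _ _ h).2 rfl

/-- The converse of (U-rich Ĉ) holds in every EDC-lattice, by (MĈ2): both joins there are ⊤, which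
is in dual contact with nothing. -/
theorem not_dcon_of_not_con (ha : a ⊔ c = ⊤) (hb : b ⊔ d = ⊤) (h : ¬ Con c d) : ¬ DCon a b :=
  fun hab => h <| mdc2 a b d c (hb ▸ not_dcon_top_right) hab (ha ▸ not_dcon_top_left)

/-- The converse of (U-rich ≪), likewise without richness, by (M≪2). -/
theorem ntp_of_not_con (hb : b ⊔ c = ⊤) (h : ¬ Con a c) : Ntp a b := by
  refine mntp2 c a b (fun hc => h hc.symm) ?_
  rw [sup_comm, hb]
  exact ntp4 _ _ _ _ le_top ntp2 le_rfl

end Relations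

/-! ### Existence of clusters. -/

section Clans

/-- Under (Nor 1), the elements in contact with every member of a clan form a cluster. -/
theorem IsClan.isCluster_setOf_con (hN : Nor1 D) {Γ : Set D} (hΓ : IsClan Γ) :
    IsCluster {a : D | ∀ b ∈ Γ, Con a b} where
  top_mem b hb := hΓ.con _ _ hΓ.top_mem hb
  bot_notMem h := (c1 _ _ (h ⊤ hΓ.top_mem)).1 rfl
  mem_of_le a b ha hab c hc := (ha c hc).mono hab le_rfl
  mem_or_mem a b hab := by
    by_contra! hcon
    simp only [Set.mem_ofPred_eq, not_forall] at hcon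
    obtain ⟨⟨u, hu, hau⟩, v, hv, hbv⟩ := hcon
    obtain ⟨c, d, hcd, hac, hud⟩ := hN _ _ hau
    obtain ⟨c', d', hcd', hbc', hvd'⟩ := hN _ _ hbv
    have hd : d ∉ Γ := fun h => hud (hΓ.con _ _ hu h)
    have hd' : d' ∉ Γ := fun h => hvd' (hΓ.con _ _ hv h)
    -- Clans need not be closed under meets, so c · c' is put into Γ by primality: it joins with d +
    -- d' to ⊤, and d, d' lie outside Γ.
    have htop : c ⊓ c' ⊔ (d ⊔ d') = ⊤ := by
      rw [sup_inf_right, ← sup_assoc, hcd, top_sup_eq, top_inf_eq, sup_left_comm, hcd', sup_top_eq]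
    have hmem : c ⊓ c' ∈ Γ := by
      rcases hΓ.mem_or_mem _ _ (htop ▸ hΓ.top_mem) with h | h
      · exact h
      · exact absurd (hΓ.mem_or_mem _ _ h) (by tauto)
    rcases c3 _ _ _ (hab _ hmem).symm with h | h
    · exact hac (h.symm.mono le_rfl inf_le_left)
    · exact hbc' (h.symm.mono le_rfl inf_le_right)
  con a b ha hb := by
    by_contra h
    obtain ⟨c, d, hcd, hac, hbd⟩ := hN _ _ h
    rcases hΓ.mem_or_mem c d (hcd ▸ hΓ.top_mem) with h | h
    · exact hac (ha _ h)
    · exact hbd (hb _ h)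
  mem_of_con a ha b hb := ha b fun c hc => hΓ.con _ _ hb hc

theorem isClan_compl_of_isPrime {J : Order.Ideal D} (hJ : J.IsPrime) :
    IsClan ((J : Set D)ᶜ) where
  top_mem := hJ.toIsProper.top_notMem
  bot_notMem h := h J.bot_mem
  mem_of_le a b ha hab hb := ha (J.lower hab hb)
  mem_or_mem a b hab := by
    by_contra! h
    simp only [Set.mem_compl_iff, not_not] at h
    exact hab (Order.Ideal.sup_mem h.1 h.2)
  con a b ha hb := c5 _ _ fun h =>
    (hJ.mem_or_mem (h ▸ J.bot_mem : a ⊓ b ∈ J)).elim ha hb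

/-- The ideal of elements which are not in contact with `a`. -/
def notConIdeal (a : D) : Order.Ideal D where
  carrier := {x | ¬ Con a x}
  lower' _ _ hyx hx hy := hx (hy.mono le_rfl hyx)
  nonempty' := ⟨⊥, fun h => (c1 _ _ h).2 rfl⟩
  directed' _ hx _ hy := ⟨_ ⊔ _, fun h => (c3 _ _ _ h).elim hx hy, le_sup_left, le_sup_right⟩

theorem mem_notConIdeal {a x : D} : x ∈ notConIdeal a ↔ ¬ Con a x := Iff.rfl

/-- Separate the filter of b from the ideal of non-contacts of a by a prime ideal. Its complement is
a clan that contains b and whose members are all in contact with a, so the associated cluster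
contains both. -/
theorem Con.exists_isCluster (hN : Nor1 D) {a b : D} (h : Con a b) :
    ∃ Γ : Set D, IsCluster Γ ∧ a ∈ Γ ∧ b ∈ Γ := by
  have hdisj : Disjoint (Order.PFilter.principal b : Set D) (notConIdeal a : Set D) := by
    rw [Set.disjoint_left]
    intro x hx hx'
    exact hx' (h.mono le_rfl (Order.PFilter.mem_principal.1 hx))
  obtain ⟨J, hJ, hle, hdis⟩ := DistribLattice.prime_ideal_of_disjoint_filter_ideal hdisj
  have hclan := isClan_compl_of_isPrime hJ
  have hb : b ∈ (J : Set D)ᶜ :=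
    Set.disjoint_left.1 hdis (Order.PFilter.mem_principal.2 le_rfl)
  refine ⟨_, hclan.isCluster_setOf_con hN, fun u hu => ?_, fun u hu => hclan.con _ _ hb hu⟩
  by_contra hau
  exact hu (hle (mem_notConIdeal.2 hau))

end Clans

/-! ### Topology of the space of clusters. -/

section ClusterSpace

theorem clustersContaining_bot : clustersContaining (⊥ : D) = ∅ :=
  Set.eq_empty_of_forall_notMem fun Γ h => Γ.2.bot_notMem h

theorem clustersContaining_top : clustersContaining (⊤ : D) = Set.univ :=
  Set.eq_univ_of_forall fun Γ => Γ.2.top_mem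

theorem clustersContaining_mono {a b : D} (h : a ≤ b) :
    clustersContaining a ⊆ clustersContaining b :=
  fun Γ hΓ => Γ.2.mem_of_le _ _ hΓ h

theorem clustersContaining_sup (a b : D) :
    clustersContaining (a ⊔ b) = clustersContaining a ∪ clustersContaining b :=
  Set.Subset.antisymm (fun Γ h => Γ.2.mem_or_mem _ _ h)
    (Set.union_subset (clustersContaining_mono le_sup_left) (clustersContaining_mono le_sup_right))

theorem clustersContaining_inter_nonempty_iff (hN : Nor1 D) {a b : D} :
    (clustersContaining a ∩ clustersContaining b).Nonempty ↔ Con a b := by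
  refine ⟨fun ⟨Γ, ha, hb⟩ => Γ.2.con _ _ ha hb, fun h => ?_⟩
  obtain ⟨Γ, hΓ, ha, hb⟩ := h.exists_isCluster hN
  exact ⟨⟨Γ, hΓ⟩, ha, hb⟩

/-- If a ≰ b, (Ext Ô) gives c with a + c = 1 ≠ b + c, and (Ext C) gives e ≠ 0 not in contact with b
+ c. A cluster through e misses b and c, hence contains a. -/
theorem clustersContaining_subset_iff (hO : ExtUnderlap D) (hE : ExtC D) (hN : Nor1 D) {a b : D} :
    clustersContaining a ⊆ clustersContaining b ↔ a ≤ b := by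
  refine ⟨fun h => ?_, clustersContaining_mono⟩
  by_contra hab
  obtain ⟨c, hac, hbc⟩ := hO _ _ hab
  obtain ⟨e, he, hcon⟩ := hE _ hbc
  obtain ⟨Γ, hΓ, hΓe, -⟩ := (con_self he).exists_isCluster hN
  have hnot : b ⊔ c ∉ Γ := fun hmem => hcon (hΓ.con _ _ hmem hΓe)
  rcases hΓ.mem_or_mem a c (hac ▸ hΓ.top_mem) with ha | hc
  · exact hnot (hΓ.mem_of_le _ _ (@h ⟨Γ, hΓ⟩ ha) le_sup_left)
  · exact hnot (hΓ.mem_of_le _ _ hc le_sup_right)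

theorem clustersContaining_eq_univ_iff (hO : ExtUnderlap D) (hE : ExtC D) (hN : Nor1 D) {a : D} :
    clustersContaining a = Set.univ ↔ a = ⊤ := by
  rw [← Set.univ_subset_iff, ← clustersContaining_top, clustersContaining_subset_iff hO hE hN,
    top_le_iff]

theorem compl_clustersContaining_subset_iff (hO : ExtUnderlap D) (hE : ExtC D) (hN : Nor1 D)
    {a c : D} : (clustersContaining c)ᶜ ⊆ clustersContaining a ↔ a ⊔ c = ⊤ := by
  rw [Set.compl_subset_iff_union, Set.union_comm, ← clustersContaining_sup,
    clustersContaining_eq_univ_iff hO hE hN]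

theorem isClosed_clustersContaining (a : D) : IsClosed (clustersContaining a) :=
  isOpen_compl_iff.1 (TopologicalSpace.isOpen_generateFrom_of_mem ⟨a, rfl⟩)

theorem isTopologicalBasis_compl_clustersContaining :
    TopologicalSpace.IsTopologicalBasis
      (Set.range fun a : D => (clustersContaining a)ᶜ) where
  exists_subset_inter := by
    rintro _ ⟨a, rfl⟩ _ ⟨b, rfl⟩ Γ hΓ
    refine ⟨(clustersContaining a)ᶜ ∩ (clustersContaining b)ᶜ, ⟨a ⊔ b, ?_⟩, hΓ, subset_rfl⟩
    rw [← Set.compl_union, ← clustersContaining_sup]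
  sUnion_eq := Set.eq_univ_of_univ_subset <|
    (by simp [clustersContaining_bot] : Set.univ ⊆ (clustersContaining (⊥ : D))ᶜ).trans <|
      Set.subset_sUnion_of_mem ⟨⊥, rfl⟩
  eq_generateFrom := rfl

theorem exists_notMem_and_compl_subset {s : Set (ClusterSpace D)} (hs : IsOpen s)
    {Γ : ClusterSpace D} (hΓ : Γ ∈ s) :
    ∃ c : D, Γ ∉ clustersContaining c ∧ (clustersContaining c)ᶜ ⊆ s := by
  obtain ⟨_, ⟨c, rfl⟩, hc, hcs⟩ :=
    isTopologicalBasis_compl_clustersContaining.exists_subset_of_mem_open hΓ hs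
  exact ⟨c, hc, hcs⟩

theorem t2Space_clusterSpace (hN : Nor1 D) : T2Space (ClusterSpace D) := by
  refine ⟨fun Γ Δ hne => ?_⟩
  -- Distinct clusters are incomparable: members of a larger cluster are in contact with all of the
  -- smaller one.
  have hsub : ¬ Γ.1 ⊆ Δ.1 := fun h => hne <| Subtype.ext <| h.antisymm fun a ha =>
    Γ.2.mem_of_con a fun b hb => Δ.2.con _ _ ha (h hb)
  obtain ⟨a, haΓ, haΔ⟩ := Set.not_subset.1 hsub
  obtain ⟨b, hbΔ, hab⟩ : ∃ b ∈ Δ.1, ¬ Con a b := by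
    by_contra! h
    exact haΔ (Δ.2.mem_of_con a h)
  obtain ⟨c, d, hcd, hac, hbd⟩ := hN _ _ hab
  refine ⟨(clustersContaining c)ᶜ, (clustersContaining d)ᶜ,
    (isClosed_clustersContaining c).isOpen_compl, (isClosed_clustersContaining d).isOpen_compl,
    fun h => hac (Γ.2.con _ _ haΓ h), fun h => hbd (Δ.2.con _ _ hbΔ h), ?_⟩
  rw [Set.disjoint_compl_left_iff_subset, Set.compl_subset_iff_union, Set.union_comm,
    ← clustersContaining_sup, hcd, clustersContaining_top]

theorem isClan_setOf_mem_ultrafilter (hN : Nor1 D) (f : Ultrafilter (ClusterSpace D)) :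
    IsClan {a : D | clustersContaining a ∈ f} where
  top_mem := by
    change clustersContaining _ ∈ f
    rw [clustersContaining_top]
    exact Filter.univ_mem
  bot_notMem h := by
    change clustersContaining _ ∈ f at h
    rw [clustersContaining_bot] at h
    exact f.empty_notMem h
  mem_of_le a b ha hab := Filter.mem_of_superset ha (clustersContaining_mono hab)
  mem_or_mem a b hab := by
    change clustersContaining _ ∈ f at hab
    rw [clustersContaining_sup] at hab
    exact Ultrafilter.union_mem_iff.1 hab
  con a b ha hb := (clustersContaining_inter_nonempty_iff hN).1 <|
    f.nonempty_of_mem (Filter.inter_mem ha hb)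

theorem compactSpace_clusterSpace (hN : Nor1 D) : CompactSpace (ClusterSpace D) := by
  refine ⟨isCompact_iff_ultrafilter_le_nhds.2 fun f _ => ?_⟩
  have hclan := isClan_setOf_mem_ultrafilter hN f
  -- The limit of f is the cluster of its clan: if h(a) ∈ f, then a is in the clan and hence in that
  -- cluster.
  refine ⟨(⟨_, hclan.isCluster_setOf_con hN⟩ : {Γ : Set D // IsCluster Γ}), trivial,
    isTopologicalBasis_compl_clustersContaining.nhds_hasBasis.ge_iff.2 ?_⟩
  rintro _ ⟨⟨a, rfl⟩, hs⟩
  refine Ultrafilter.compl_mem_iff_notMem.2 ?_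
  exact fun ha => hs fun b hb => hclan.con _ _ ha hb

/-- If h(b) contains the interior of h(a), then a + c = 1 forces b + c = 1, since the complement of
h(c) is open and inside h(a); (Ext Ô) then gives a ≤ b. -/
theorem closure_interior_clustersContaining (hO : ExtUnderlap D) (hE : ExtC D) (hN : Nor1 D)
    (a : D) : closure (interior (clustersContaining a)) = clustersContaining a := by
  refine (closure_minimal interior_subset (isClosed_clustersContaining a)).antisymm
    fun Γ ha => ?_
  by_contra hΓ
  obtain ⟨b, hb, hsub⟩ := exists_notMem_and_compl_subset isClosed_closure.isOpen_compl hΓ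
  have hsub' : interior (clustersContaining a) ⊆ clustersContaining b :=
    subset_closure.trans (Set.compl_subset_compl.1 hsub)
  refine hb (clustersContaining_mono ?_ ha)
  by_contra hab
  obtain ⟨c, hac, hbc⟩ := hO _ _ hab
  exact hbc <| (compl_clustersContaining_subset_iff hO hE hN).1 <|
    (interior_maximal ((compl_clustersContaining_subset_iff hO hE hN).2 hac)
      (isClosed_clustersContaining c).isOpen_compl).trans hsub'

theorem closure_interior_inter_clustersContaining (hO : ExtUnderlap D) (hE : ExtC D) (hN : Nor1 D)
    (a b : D) : closure (interior (clustersContaining a ∩ clustersContaining b)) =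
      clustersContaining (a ⊓ b) := by
  refine Set.Subset.antisymm (closure_minimal (fun Γ hΓ => ?_) (isClosed_clustersContaining _)) ?_
  · obtain ⟨c, hc, hsub⟩ := exists_notMem_and_compl_subset isOpen_interior hΓ
    have hsub' := Set.subset_inter_iff.1 (hsub.trans interior_subset)
    rw [compl_clustersContaining_subset_iff hO hE hN,
      compl_clustersContaining_subset_iff hO hE hN] at hsub'
    have htop : a ⊓ b ⊔ c = ⊤ := by rw [sup_inf_right, hsub'.1, hsub'.2, inf_idem]
    exact (Γ.2.mem_or_mem _ _ (htop ▸ Γ.2.top_mem)).resolve_right hc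
  · rw [← closure_interior_clustersContaining hO hE hN (a ⊓ b)]
    exact closure_mono <| interior_mono <| Set.subset_inter
      (clustersContaining_mono inf_le_left) (clustersContaining_mono inf_le_right)

end ClusterSpace

/-! ### The embedding and its separability. -/

section Embedding

/-- The canonical map into the regular closed sets of the space of clusters. -/
def clusterMap (hO : ExtUnderlap D) (hE : ExtC D) (hN : Nor1 D) (a : D) :
    RegularClosed (ClusterSpace D) :=
  ⟨clustersContaining a, closure_interior_clustersContaining hO hE hN a⟩

variable (hO : ExtUnderlap D) (hE : ExtC D) (hN : Nor1 D)

theorem clusterMap_le_iff {a b : D} : clusterMap hO hE hN a ≤ clusterMap hO hE hN b ↔ a ≤ b :=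
  clustersContaining_subset_iff hO hE hN

theorem clusterMap_bot : clusterMap hO hE hN ⊥ = ⊥ :=
  RegularClosed.ext clustersContaining_bot

theorem clusterMap_top : clusterMap hO hE hN ⊤ = ⊤ :=
  RegularClosed.ext clustersContaining_top

theorem clusterMap_sup (a b : D) :
    clusterMap hO hE hN (a ⊔ b) = clusterMap hO hE hN a ⊔ clusterMap hO hE hN b :=
  RegularClosed.ext (clustersContaining_sup a b)

theorem clusterMap_inf (a b : D) :
    clusterMap hO hE hN (a ⊓ b) = clusterMap hO hE hN a ⊓ clusterMap hO hE hN b :=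
  RegularClosed.ext (closure_interior_inter_clustersContaining hO hE hN a b).symm

theorem clusterMap_injective : Function.Injective (clusterMap hO hE hN) := fun _ _ h =>
  le_antisymm ((clusterMap_le_iff hO hE hN).1 h.le) ((clusterMap_le_iff hO hE hN).1 h.ge)

theorem con_clusterMap_iff {a b : D} :
    Con (clusterMap hO hE hN a) (clusterMap hO hE hN b) ↔ Con a b :=
  clustersContaining_inter_nonempty_iff hN

theorem compl_le_clusterMap_iff {α : RegularClosed (ClusterSpace D)} {c : D} :
    αᶜ ≤ clusterMap hO hE hN c ↔ α ⊔ clusterMap hO hE hN c = ⊤ := by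
  rw [← codisjoint_iff_compl_le_right, codisjoint_iff]

theorem compl_clusterMap_le_iff {a c : D} :
    (clusterMap hO hE hN a)ᶜ ≤ clusterMap hO hE hN c ↔ a ⊔ c = ⊤ := by
  rw [compl_le_clusterMap_iff, ← clusterMap_sup, ← clusterMap_top hO hE hN,
    (clusterMap_injective hO hE hN).eq_iff]

theorem iInter_clusterMap_eq (α : RegularClosed (ClusterSpace D)) :
    ⋂ a : {a : D // α ≤ clusterMap hO hE hN a}, clustersContaining a.1 = α.carrier := by
  refine Set.Subset.antisymm (fun Γ hΓ => ?_) (Set.subset_iInter fun a => a.2)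
  by_contra hα
  obtain ⟨c, hc, hsub⟩ := exists_notMem_and_compl_subset α.isClosed.isOpen_compl hα
  exact hc (Set.mem_iInter.1 hΓ ⟨c, Set.compl_subset_compl.1 hsub⟩)

/-- Compactness of F, applied to the family of basic closed sets containing α, whose intersection is
α. -/
theorem exists_le_clusterMap_disjoint {α : RegularClosed (ClusterSpace D)}
    {F : Set (ClusterSpace D)} (hF : IsClosed F) (h : F ∩ α.carrier = ∅) :
    ∃ a : D, α ≤ clusterMap hO hE hN a ∧ F ∩ clustersContaining a = ∅ := by
  have := compactSpace_clusterSpace hN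
  have : Nonempty {a : D // α ≤ clusterMap hO hE hN a} :=
    ⟨⟨⊤, by rw [clusterMap_top]; exact le_top⟩⟩
  obtain ⟨⟨a, ha⟩, hFa⟩ := hF.isCompact.elim_directed_family_closed
    (fun a : {a : D // α ≤ clusterMap hO hE hN a} => clustersContaining a.1)
    (fun a => isClosed_clustersContaining a.1) (by rwa [iInter_clusterMap_eq hO hE hN])
    -- The family is directed because α is regular closed: h(a · b) may be smaller than h(a) ∩ h(b),
    -- but it is the meet in RC(X).
    (fun a b => ⟨⟨a.1 ⊓ b.1, (clusterMap_inf hO hE hN a.1 b.1).symm ▸ le_inf a.2 b.2⟩,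
      clustersContaining_mono inf_le_left, clustersContaining_mono inf_le_right⟩)
  exact ⟨a, ha, hFa⟩

theorem exists_clusterMap_not_con {α β : RegularClosed (ClusterSpace D)} (h : ¬ Con α β) :
    ∃ a b : D, α ≤ clusterMap hO hE hN a ∧ β ≤ clusterMap hO hE hN b ∧
      ¬ Con (clusterMap hO hE hN a) (clusterMap hO hE hN b) := by
  have h' : β.carrier ∩ α.carrier = ∅ := by
    rw [Set.inter_comm]
    exact Set.not_nonempty_iff_eq_empty.1 h
  -- Enlarge α first, then β against the enlarged set.
  obtain ⟨a, ha, hβa⟩ := exists_le_clusterMap_disjoint hO hE hN β.isClosed h'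
  rw [Set.inter_comm] at hβa
  obtain ⟨b, hb, hab⟩ :=
    exists_le_clusterMap_disjoint hO hE hN (isClosed_clustersContaining a) hβa
  exact ⟨a, b, ha, hb, Set.not_nonempty_iff_eq_empty.2 hab⟩

theorem cSeparable_clusterMap : CSeparable (clusterMap hO hE hN) where
  con _ _ h := exists_clusterMap_not_con hO hE hN h
  dcon α β h := by
    obtain ⟨a, b, ha, hb, hab⟩ := exists_clusterMap_not_con hO hE hN (α := αᶜ) (β := βᶜ) h
    exact ⟨a, b, (compl_le_clusterMap_iff hO hE hN).1 ha, (compl_le_clusterMap_iff hO hE hN).1 hb,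
      hab⟩
  ntp α β h := by
    obtain ⟨a, b, ha, hb, hab⟩ := exists_clusterMap_not_con hO hE hN (α := α) (β := βᶜ) h
    exact ⟨a, b, ha, (compl_le_clusterMap_iff hO hE hN).1 hb, hab⟩

theorem dcon_clusterMap_iff (hD : URichDCon D) {a b : D} :
    DCon (clusterMap hO hE hN a) (clusterMap hO hE hN b) ↔ DCon a b := by
  rw [← not_iff_not]
  constructor
  · intro h
    obtain ⟨c, d, hc, hd, hcd⟩ := exists_clusterMap_not_con hO hE hN
      (α := (clusterMap hO hE hN a)ᶜ) (β := (clusterMap hO hE hN b)ᶜ) h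
    rw [con_clusterMap_iff] at hcd
    exact not_dcon_of_not_con ((compl_clusterMap_le_iff hO hE hN).1 hc)
      ((compl_clusterMap_le_iff hO hE hN).1 hd) hcd
  · intro h
    obtain ⟨c, d, hc, hd, hcd⟩ := hD _ _ h
    rw [← con_clusterMap_iff hO hE hN] at hcd
    exact fun hab => hcd <| Con.mono
      (a := (clusterMap hO hE hN a)ᶜ) (b := (clusterMap hO hE hN b)ᶜ) hab
      ((compl_clusterMap_le_iff hO hE hN).2 hc) ((compl_clusterMap_le_iff hO hE hN).2 hd)

theorem ntp_clusterMap_iff (hR : URichNtp D) {a b : D} :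
    Ntp (clusterMap hO hE hN a) (clusterMap hO hE hN b) ↔ Ntp a b := by
  constructor
  · intro h
    obtain ⟨c, d, hc, hd, hcd⟩ := exists_clusterMap_not_con hO hE hN
      (α := clusterMap hO hE hN a) (β := (clusterMap hO hE hN b)ᶜ) h
    rw [con_clusterMap_iff] at hcd
    exact ntp_of_not_con ((compl_clusterMap_le_iff hO hE hN).1 hd)
      fun had => hcd (had.mono ((clusterMap_le_iff hO hE hN).1 hc) le_rfl)
  · intro h
    obtain ⟨c, hc, hac⟩ := hR _ _ h
    rw [← con_clusterMap_iff hO hE hN] at hac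
    exact fun hab => hac <| Con.mono
      (a := clusterMap hO hE hN a) (b := (clusterMap hO hE hN b)ᶜ) hab le_rfl
      ((compl_clusterMap_le_iff hO hE hN).2 hc)

theorem isEmbedding_clusterMap (hR : URichNtp D) (hD : URichDCon D) :
    IsEmbedding (clusterMap hO hE hN) where
  injective := clusterMap_injective hO hE hN
  map_bot := clusterMap_bot hO hE hN
  map_top := clusterMap_top hO hE hN
  map_sup := clusterMap_sup hO hE hN
  map_inf := clusterMap_inf hO hE hN
  con_iff _ _ := con_clusterMap_iff hO hE hN
  dcon_iff _ _ := dcon_clusterMap_iff hO hE hN hD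
  ntp_iff _ _ := ntp_clusterMap_iff hO hE hN hR

theorem duallyDense_clusterMap : DuallyDense (clusterMap hO hE hN) := by
  intro α hα
  obtain ⟨Γ, hΓ⟩ : ∃ Γ, Γ ∉ α.carrier := by
    by_contra! h
    exact hα (RegularClosed.ext (Set.eq_univ_of_forall h))
  obtain ⟨c, hc, hsub⟩ := exists_notMem_and_compl_subset α.isClosed.isOpen_compl hΓ
  refine ⟨c, Set.compl_subset_compl.1 hsub, fun h => hc ?_⟩
  have h' : clustersContaining c = Set.univ := congrArg RegularClosed.carrier h
  rw [h']
  trivial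

end Embedding

/-! ### Transfer of (Con C) and connectedness. -/

section Connectedness

variable {D₁ D₂ : Type*} [EDCLattice D₁] [EDCLattice D₂] {h : D₁ → D₂}

theorem IsEmbedding.conC (hh : IsEmbedding h) (hC : ConC D₂) : ConC D₁ := by
  intro a b ha hb hab
  rw [← hh.con_iff]
  refine hC _ _ ?_ ?_ ?_
  · rwa [← hh.map_bot, hh.injective.ne_iff]
  · rwa [← hh.map_bot, hh.injective.ne_iff]
  · rw [← hh.map_sup, hab, hh.map_top]

/-- A counterexample α, β enlarges by separability to h(a), h(b), which is a counterexample in the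
first lattice. -/
theorem IsEmbedding.conC_of_cSeparable (hh : IsEmbedding h) (hs : CSeparable h) (hC : ConC D₁) :
    ConC D₂ := by
  intro α β hα hβ hαβ
  by_contra hcon
  obtain ⟨a, b, ha, hb, hab⟩ := hs.con _ _ hcon
  rw [hh.con_iff] at hab
  refine hab (hC _ _ ?_ ?_ ?_)
  · rintro rfl
    exact hα (le_bot_iff.1 (hh.map_bot ▸ ha))
  · rintro rfl
    exact hβ (le_bot_iff.1 (hh.map_bot ▸ hb))
  · apply hh.injective
    rw [hh.map_sup, hh.map_top]
    exact top_le_iff.1 (hαβ ▸ sup_le_sup ha hb)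

/-- Clopen sets are regular closed, so a clopen splitting violates (Con C). Nonemptiness is not
claimed: X is empty when ⊥ = ⊤ in D. -/
theorem preconnectedSpace_of_conC_regularClosed {X : Type*} [TopologicalSpace X]
    (hC : ConC (RegularClosed X)) : PreconnectedSpace X := by
  refine preconnectedSpace_iff_clopen.2 fun s hs => ?_
  by_contra! hne
  have hreg : ∀ t : Set X, IsClopen t → closure (interior t) = t := fun t ht => by
    rw [ht.isOpen.interior_eq, ht.isClosed.closure_eq]
  obtain ⟨x, hx, hx'⟩ := hC ⟨s, hreg s hs⟩ ⟨sᶜ, hreg _ hs.compl⟩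
    (fun h => hne.1.ne_empty (congrArg RegularClosed.carrier h))
    (fun h => hne.2 (Set.compl_empty_iff.1 (congrArg RegularClosed.carrier h)))
    (RegularClosed.ext (Set.union_compl_self s))
  exact hx' hx

end Connectedness

end EDCLattice

theorem mainTheorem10 {D : Type*} [EDCLattice D] (hU : EDCLattice.URich D)
    (hE : EDCLattice.ExtC D) (hN : EDCLattice.Nor1 D) :
    CompactSpace (EDCLattice.ClusterSpace D) ∧
    T2Space (EDCLattice.ClusterSpace D) ∧
    TopologicalSpace.IsTopologicalBasis
      (Set.range fun a : D => (EDCLattice.clustersContaining a)ᶜ) ∧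
    (∃ h : D → RegularClosed (EDCLattice.ClusterSpace D),
      (∀ a : D, (h a).carrier = EDCLattice.clustersContaining a) ∧
      EDCLattice.IsEmbedding h ∧
      EDCLattice.DuallyDense h ∧
      EDCLattice.CSeparable h) ∧
    (EDCLattice.ConC D ↔ EDCLattice.ConC (RegularClosed (EDCLattice.ClusterSpace D))) ∧
    (EDCLattice.ConC D → PreconnectedSpace (EDCLattice.ClusterSpace D)) := by
  obtain ⟨hO, hR, hD⟩ := hU
  have hemb := EDCLattice.isEmbedding_clusterMap hO hE hN hR hD
  have hsep := EDCLattice.cSeparable_clusterMap hO hE hN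
  have hconC := hemb.conC_of_cSeparable hsep
  exact ⟨EDCLattice.compactSpace_clusterSpace hN, EDCLattice.t2Space_clusterSpace hN,
    EDCLattice.isTopologicalBasis_compl_clustersContaining,
    ⟨EDCLattice.clusterMap hO hE hN, fun _ => rfl, hemb,
      EDCLattice.duallyDense_clusterMap hO hE hN, hsep⟩,
    ⟨hconC, hemb.conC⟩,
    fun hC => EDCLattice.preconnectedSpace_of_conC_regularClosed (hconC hC)⟩
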